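/- For a real number $x$ let $\|x\|$ denote the distance from $x$ to the nearest integer. Let $(q_n)_{n\ge 1}$ be a strictly increasing sequence of positive real numbers with $\lim_{n\to\infty}(q_{n+1}-q_n)=\infty$, and let $(r_n)_{n\ge 1}$ be an arbitrary sequence of real numbers. Then the set $$E(q_n,r_n)=\Big\{\alpha\in(1,\infty) : \lim_{n\to\infty}\|\alpha^{q_n}-r_n\|=0\Big\}$$ is dense in $(1,\infty)$ and has Hausdorff dimension $1$. Moreover, for every $\lambda>1$ and every $\delta>0$, the set $[\lambda,\lambda+\delta]\cap E(q_n,r_n)$ has Hausdorff dimension $1$. -/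

import Mathlib

open Filter Topology Set

/-- The distance from a real number to the nearest integer. -/
noncomputable def distNearestInt (x : ℝ) : ℝ := |x - (round x : ℝ)|

/-- The set `E(q_n, r_n)` of all `α > 1` with `‖α ^ q_n - r_n‖ → 0`, where `‖·‖` is the distance
to the nearest integer. The exponents are real. -/
def powerApproxSet (q r : ℕ → ℝ) : Set ℝ :=
  {α : ℝ | 1 < α ∧ Tendsto (fun n => distNearestInt (α ^ q n - r n)) atTop (𝓝 0)}

/-! Put `t = log α`, so that the condition reads `exp (q n * t)` close to `r n` modulo 1. To get
dimension at least `s < 1`, fix any cover-like family of obstacles `U i` of sizes `d i` with small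
total weight `∑ d i ^ s`, and build nested intervals whose common point lies in the set but in no `U
i`. The invariant is that the obstacles meeting an interval of length `ℓ` weigh at most `ℓ ^ s /
24`. If `exp (q t)` increases by at least `R` on the interval, the interval splits into cells of
length `c ≤ ℓ / R`, each holding a child of length at least `ε c` where the approximation is within
`ε`. Averaging (`exists_sum_indicator_le`) gives a child of weight at most `4 ℓ ^ (s - 1) c / 24`,
which is at most `(ε c) ^ s / 24` once `4 ≤ ε R ^ (1 - s)` (`exists_subinterval`). The next `R` is
`ε n` times the exponential of `L` times the gap. Since the gaps tend to infinity, `ε n` can tend to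
zero while this inequality persists (`exists_tolerances`). -/

/-! ### Lower bounds for dimension by avoiding covers -/

open MeasureTheory in
/-- A lower bound for the Hausdorff dimension: every countable family of sets of small total
`s`-dimensional size misses a point of `A`. -/
theorem le_dimH_of_forall_exists_notMem {X : Type*} [MetricSpace X] {A : Set X} {s c : ℝ}
    (hs : 0 < s) (hc : 0 < c)
    (H : ∀ (U : ℕ → Set X) (d : ℕ → ℝ), (∀ i, 0 < d i) →
      (∀ i, ∀ x ∈ U i, ∀ y ∈ U i, dist x y ≤ d i) → Summable (fun i => d i ^ s) →
      ∑' i, d i ^ s ≤ c → ∃ x ∈ A, ∀ i, x ∉ U i) :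
    ENNReal.ofReal s ≤ dimH A := by
  borelize X
  have hs' : ((s.toNNReal : NNReal) : ℝ) = s := Real.coe_toNNReal s hs.le
  refine le_dimH_of_hausdorffMeasure_ne_zero (d := s.toNNReal) fun h0 => ?_
  rw [hs', Measure.hausdorffMeasure_apply] at h0
  have h1 := ENNReal.iSup_eq_zero.1 (ENNReal.iSup_eq_zero.1 h0 1) one_pos
  have hlt := h1.trans_lt (ENNReal.ofReal_pos.2 (half_pos hc))
  simp only [iInf_lt_iff] at hlt
  obtain ⟨t, hcov, hdiam, hsum⟩ := hlt
  have hfin : ∀ i, Metric.ediam (t i) ≠ ⊤ := fun i =>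
    ((hdiam i).trans_lt ENNReal.one_lt_top).ne
  have hterm : ∀ i, ENNReal.ofReal (Metric.diam (t i) ^ s) ≤
      ⨆ _ : (t i).Nonempty, Metric.ediam (t i) ^ s := by
    intro i
    rcases (t i).eq_empty_or_nonempty with h | h
    · simp [h, Real.zero_rpow hs.ne']
    · rw [iSup_pos h, ← ENNReal.ofReal_rpow_of_nonneg Metric.diam_nonneg hs.le, Metric.diam,
        ENNReal.ofReal_toReal (hfin i)]
  have hle : ∑' i, ENNReal.ofReal (Metric.diam (t i) ^ s) ≤ ENNReal.ofReal (c / 2) :=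
    (ENNReal.tsum_le_tsum hterm).trans hsum.le
  have hnn : ∀ i, 0 ≤ Metric.diam (t i) ^ s := fun i => Real.rpow_nonneg Metric.diam_nonneg s
  have hsm : Summable fun i => Metric.diam (t i) ^ s := by
    have := ENNReal.summable_toReal (hle.trans_lt ENNReal.ofReal_lt_top).ne
    simpa only [ENNReal.toReal_ofReal (hnn _)] using this
  have hle' : ∑' i, Metric.diam (t i) ^ s ≤ c / 2 := by
    rw [← ENNReal.ofReal_tsum_of_nonneg hnn hsm] at hle
    exact (ENNReal.ofReal_le_ofReal_iff (by positivity)).1 hle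
  -- Diameters may vanish but sizes must be positive: `c / 2 ^ (i + 2)` is added to each weight, at
  -- total cost `c / 2`.
  have hgeom : HasSum (fun i : ℕ => c / 2 / 2 / 2 ^ i) (c / 2) := hasSum_geometric_two' (c / 2)
  have hpos : ∀ i, 0 < Metric.diam (t i) ^ s + c / 2 / 2 / 2 ^ i := fun i =>
    add_pos_of_nonneg_of_pos (hnn i) (by positivity)
  have hpow : ∀ i, ((Metric.diam (t i) ^ s + c / 2 / 2 / 2 ^ i) ^ s⁻¹) ^ s =
      Metric.diam (t i) ^ s + c / 2 / 2 / 2 ^ i := fun i => by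
    rw [← Real.rpow_mul (hpos i).le, inv_mul_cancel₀ hs.ne', Real.rpow_one]
  obtain ⟨x, hxA, hx⟩ := H t (fun i => (Metric.diam (t i) ^ s + c / 2 / 2 / 2 ^ i) ^ s⁻¹)
    (fun i => Real.rpow_pos_of_pos (hpos i) _)
    (fun i x hx y hy => by
      refine (Metric.dist_le_diam_of_mem' (hfin i) hx hy).trans ?_
      rw [← Real.rpow_le_rpow_iff Metric.diam_nonneg (Real.rpow_nonneg (hpos i).le _) hs, hpow]
      have : 0 < c / 2 / 2 / 2 ^ i := by positivity
      linarith)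
    (by simpa only [hpow] using hsm.add hgeom.summable)
    (by
      simp only [hpow]
      rw [hsm.tsum_add hgeom.summable, hgeom.tsum_eq]
      linarith)
  obtain ⟨i, hi⟩ := mem_iUnion.1 (hcov hxA)
  exact hx i hi

/-! ### Choosing a child that meets few obstacles -/

/-- Averaging over the children of an interval of length `ℓ`: `C k` is the length of the `k`-th cell
and `H k` the set of obstacles met by its child. If an obstacle that meets two children is as long
as the cells between them, up to a constant, then some child meets few obstacles. -/
theorem exists_sum_indicator_le {ι : Type*} {s ℓ : ℝ} (hs : 0 < s) (hs1 : s < 1) (hℓ : 0 < ℓ)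
    {d : ι → ℝ} (hd : ∀ i, 0 < d i) (hsum : Summable fun i => d i ^ s) {S : Set ι}
    (hS : ∑' i, S.indicator (fun i => d i ^ s) i ≤ ℓ ^ s / 24)
    {N : ℕ} {C : ℕ → ℝ} (hC : ∀ k < N, 0 < C k) (hCsum : ℓ / 2 ≤ ∑ k ∈ Finset.range N, C k)
    {H : ℕ → Set ι} (hHS : ∀ k < N, H k ⊆ S)
    (hmulti : ∀ i k l, k < l → l < N → i ∈ H k → i ∈ H l →
      ∑ j ∈ Finset.Ico k (l + 1), C j ≤ 6 * d i) :
    ∃ k < N, ∑' i, (H k).indicator (fun i => d i ^ s) i ≤ 4 * ℓ ^ (s - 1) * C k / 24 := by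
  classical
  have hw : ∀ i, 0 < d i ^ s := fun i => Real.rpow_pos_of_pos (hd i) s
  have hdS : ∀ i ∈ S, d i ≤ ℓ := by
    intro i hi
    have h1 : d i ^ s ≤ ∑' i, S.indicator (fun i => d i ^ s) i := by
      have := (hsum.indicator S).le_tsum i fun j _ => indicator_nonneg (fun i _ => (hw i).le) j
      rwa [indicator_of_mem hi] at this
    have h2 : 0 < ℓ ^ s := Real.rpow_pos_of_pos hℓ s
    exact (Real.rpow_le_rpow_iff (hd i).le hℓ.le hs).1 (by linarith)
  have hdw : ∀ i ∈ S, d i ≤ ℓ ^ (1 - s) * d i ^ s := by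
    intro i hi
    calc d i = d i ^ (1 - s) * d i ^ s := by rw [← Real.rpow_add (hd i)]; simp
      _ ≤ _ := by
        exact mul_le_mul_of_nonneg_right
          (Real.rpow_le_rpow (hd i).le (hdS i hi) (by linarith)) (hw i).le
  -- `P` marks obstacles meeting several children; `W` collects the children spoiled by one, `G` the
  -- others.
  let P : ι → Prop := fun i => ∃ k l, k < l ∧ l < N ∧ i ∈ H k ∧ i ∈ H l
  let W := (Finset.range N).filter fun k => ∃ i, i ∈ H k ∧ P i
  let G := (Finset.range N).filter fun k => ¬ ∃ i, i ∈ H k ∧ P i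
  have hindsum : Summable fun i => 6 * (ℓ ^ (1 - s) * S.indicator (fun i => d i ^ s) i) :=
    ((hsum.indicator S).mul_left _).mul_left _
  have hf : ∀ i, ∑ k ∈ W, (if i ∈ H k ∧ P i then C k else 0) ≤
      6 * (ℓ ^ (1 - s) * S.indicator (fun i => d i ^ s) i) := by
    intro i
    by_cases hP : P i
    · obtain ⟨k₀, l₀, hkl, hl, hk₀, hl₀⟩ := hP
      have hP : P i := ⟨k₀, l₀, hkl, hl, hk₀, hl₀⟩
      let K := (Finset.range N).filter fun k => i ∈ H k
      have hk₀K : k₀ ∈ K := by simp [K, hk₀, hkl.trans hl]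
      have hl₀K : l₀ ∈ K := by simp [K, hl₀, hl]
      have hne : K.Nonempty := ⟨_, hk₀K⟩
      have hmin := K.min'_mem hne
      have hmax := K.max'_mem hne
      have hlt : K.min' hne < K.max' hne :=
        (K.min'_le _ hk₀K).trans_lt (hkl.trans_le (K.le_max' _ hl₀K))
      have hmin' := Finset.mem_filter.1 hmin
      have hmax' := Finset.mem_filter.1 hmax
      have hiS : i ∈ S := hHS _ (Finset.mem_range.1 hmin'.1) hmin'.2
      rw [indicator_of_mem hiS]
      calc ∑ k ∈ W, (if i ∈ H k ∧ P i then C k else 0)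
          ≤ ∑ j ∈ Finset.Ico (K.min' hne) (K.max' hne + 1), C j := by
            rw [← Finset.sum_filter]
            refine Finset.sum_le_sum_of_subset_of_nonneg ?_ ?_
            · intro k hk
              simp only [W, Finset.mem_filter] at hk
              have hkK : k ∈ K := by simp only [K, Finset.mem_filter]; exact ⟨hk.1.1, hk.2.1⟩
              exact Finset.mem_Ico.2 ⟨K.min'_le _ hkK, Nat.lt_succ_of_le (K.le_max' _ hkK)⟩
            · intro k hk _
              have := (Finset.mem_Ico.1 hk).2
              have := Finset.mem_range.1 hmax'.1
              exact (hC k (by omega)).le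
        _ ≤ 6 * d i := hmulti i _ _ hlt (Finset.mem_range.1 hmax'.1) hmin'.2 hmax'.2
        _ ≤ _ := by gcongr; exact hdw i hiS
    · simp only [hP, and_false, if_false, Finset.sum_const_zero]
      have := indicator_nonneg (s := S) (fun i _ => (hw i).le) i
      have := Real.rpow_nonneg hℓ.le (1 - s)
      positivity
  have hfsum : ∀ k ∈ W, Summable fun i => if i ∈ H k ∧ P i then C k else 0 := by
    intro k hk
    refine Summable.of_nonneg_of_le (fun i => ?_) (fun i => ?_) hindsum
    · have := hC k (by simp only [W, Finset.mem_filter, Finset.mem_range] at hk; exact hk.1)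
      split_ifs <;> linarith
    · refine le_trans ?_ (hf i)
      refine Finset.single_le_sum (f := fun k => if i ∈ H k ∧ P i then C k else 0) ?_ hk
      intro j hj
      have := hC j (by simp only [W, Finset.mem_filter, Finset.mem_range] at hj; exact hj.1)
      split_ifs <;> linarith
  -- Charge each spoiled cell to an obstacle spoiling it. An obstacle pays at most `6 * d i`, and `d
  -- i ≤ ℓ`, so the constant 24 makes the total at most `ℓ / 4`.
  have hWsum : ∑ k ∈ W, C k ≤ ℓ / 4 := by
    calc ∑ k ∈ W, C k ≤ ∑ k ∈ W, ∑' i, (if i ∈ H k ∧ P i then C k else 0) := by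
          refine Finset.sum_le_sum fun k hk => ?_
          have hk' := hk
          simp only [W, Finset.mem_filter, Finset.mem_range] at hk'
          obtain ⟨hkN, i, hi⟩ := hk'
          have := (hfsum k hk).le_tsum i fun j _ => by
            have := hC k hkN
            split_ifs <;> linarith
          rwa [if_pos hi] at this
      _ = ∑' i, ∑ k ∈ W, (if i ∈ H k ∧ P i then C k else 0) :=
          (Summable.tsum_finsetSum hfsum).symm
      _ ≤ ∑' i, 6 * (ℓ ^ (1 - s) * S.indicator (fun i => d i ^ s) i) :=
          Summable.tsum_le_tsum hf (summable_sum hfsum) hindsum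
      _ = 6 * (ℓ ^ (1 - s) * ∑' i, S.indicator (fun i => d i ^ s) i) := by
          rw [tsum_mul_left, tsum_mul_left]
      _ ≤ 6 * (ℓ ^ (1 - s) * (ℓ ^ s / 24)) := by gcongr
      _ = 6 / 24 * (ℓ ^ (1 - s) * ℓ ^ s) := by ring
      _ = ℓ / 4 := by
          rw [← Real.rpow_add hℓ]
          norm_num
          ring
  have hsplit : ∑ k ∈ W, C k + ∑ k ∈ G, C k = ∑ k ∈ Finset.range N, C k :=
    Finset.sum_filter_add_sum_filter_not _ _ _
  have hGsum : ℓ / 4 ≤ ∑ k ∈ G, C k := by linarith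
  have hGne : G.Nonempty := by
    by_contra h
    rw [Finset.not_nonempty_iff_eq_empty] at h
    rw [h, Finset.sum_empty] at hGsum
    linarith
  have hsums : ∀ k ∈ G, Summable fun i => (H k).indicator (fun i => d i ^ s) i := fun k _ =>
    hsum.indicator _
  -- An obstacle meets at most one child in `G`, so no weight is counted twice.
  have hGH : ∑ k ∈ G, ∑' i, (H k).indicator (fun i => d i ^ s) i ≤ ℓ ^ s / 24 := by
    rw [← Summable.tsum_finsetSum hsums]
    refine (Summable.tsum_le_tsum (fun i => ?_) (summable_sum hsums) (hsum.indicator S)).trans hS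
    by_cases hex : ∃ k ∈ G, i ∈ H k
    · obtain ⟨k, hk, hik⟩ := hex
      have hk' := Finset.mem_filter.1 hk
      rw [Finset.sum_eq_single_of_mem k hk, indicator_of_mem hik,
        indicator_of_mem (hHS k (Finset.mem_range.1 hk'.1) hik)]
      intro l hl hlk
      refine indicator_of_notMem (fun hil => hk'.2 ⟨i, hik, ?_⟩) _
      have hl' := Finset.mem_filter.1 hl
      rcases lt_or_gt_of_ne hlk with h | h
      · exact ⟨l, k, h, Finset.mem_range.1 hk'.1, hil, hik⟩
      · exact ⟨k, l, h, Finset.mem_range.1 hl'.1, hik, hil⟩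
    · push Not at hex
      rw [Finset.sum_eq_zero fun k hk => indicator_of_notMem (hex k hk) _]
      exact indicator_nonneg (fun i _ => (hw i).le) i
  obtain ⟨k, hk, hle⟩ := Finset.exists_le_of_sum_le hGne
    (f := fun k => ∑' i, (H k).indicator (fun i => d i ^ s) i)
    (g := fun k => 4 * ℓ ^ (s - 1) * C k / 24) (by
      refine hGH.trans ?_
      rw [← Finset.sum_div, ← Finset.mul_sum]
      have h1 : ℓ ^ s = 4 * ℓ ^ (s - 1) * (ℓ / 4) := by
        rw [Real.rpow_sub_one hℓ.ne']
        field_simp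
      rw [h1]
      gcongr)
  exact ⟨k, Finset.mem_range.1 (Finset.mem_filter.1 hk).1, hle⟩

/-! ### Logarithm estimates -/

theorem log_sub_log_le {x y : ℝ} (hx : 0 < x) (hy : 0 < y) :
    Real.log y - Real.log x ≤ (y - x) / x := by
  rw [← Real.log_div hy.ne' hx.ne', sub_div, div_self hx.ne']
  exact Real.log_le_sub_one_of_pos (div_pos hy hx)

theorem le_log_sub_log {x y : ℝ} (hx : 0 < x) (hy : 0 < y) :
    (y - x) / y ≤ Real.log y - Real.log x := by
  have h := log_sub_log_le hy hx
  have : (x - y) / y = -((y - x) / y) := by ring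
  linarith

theorem distNearestInt_le (x : ℝ) (m : ℤ) : distNearestInt x ≤ |x - m| := round_le x m

/-- The gap between two children controls the cells between them. -/
theorem log_cells_le {Z D ε : ℝ} (hZ : 1 ≤ Z) (hD : 1 ≤ D) (hε : 0 < ε) (hε4 : ε ≤ 1 / 4) :
    Real.log (Z + D + 1) - Real.log Z ≤
      6 * (Real.log (Z + D) - Real.log (Z + 2 * ε)) := by
  have h1 := log_sub_log_le (x := Z + D) (y := Z + D + 1) (by linarith) (by linarith)
  have h2 := log_sub_log_le (x := Z) (y := Z + 2 * ε) (by linarith) (by linarith)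
  have h3 := le_log_sub_log (x := Z + 2 * ε) (y := Z + D) (by linarith) (by linarith)
  have h4 := le_log_sub_log (x := Z + 2 * ε) (y := Z + 1) (by linarith) (by linarith)
  have h5 : Real.log (Z + 1) ≤ Real.log (Z + D) :=
    Real.log_le_log (by linarith) (by linarith)
  -- Each end piece is at most twice the gap, so even the factor 5 would do.
  have h6 : (Z + D + 1 - (Z + D)) / (Z + D) ≤ 2 * ((Z + D - (Z + 2 * ε)) / (Z + D)) := by
    rw [← mul_div_assoc]
    gcongr
    linarith
  have h7 : (Z + 2 * ε - Z) / Z ≤ 2 * ((Z + 1 - (Z + 2 * ε)) / (Z + 1)) := by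
    rw [← mul_div_assoc, div_le_div_iff₀ (by linarith) (by linarith)]
    nlinarith
  have h8 := Real.log_le_log (by linarith : 0 < Z + 2 * ε) (by linarith : Z + 2 * ε ≤ Z + D)
  linarith

/-! ### One step of the construction -/

/-- One step of the construction: an interval `[u, v]`, in the logarithmic coordinate, which meets
few obstacles and on which `exp (q t)` covers many integers contains a subinterval on which
`exp (q t) - r` is `ε`-close to an integer and which again meets few obstacles. -/
theorem exists_subinterval {ι : Type*} {s R ε q u v r : ℝ} (hs : 0 < s) (hs1 : s < 1) (hq : 0 < q)
    (huv : u < v) (hA : 1 ≤ Real.exp (q * u)) (hRA : R ≤ q * (v - u) * Real.exp (q * u))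
    (hR : 4 ≤ R) (hε : 0 < ε) (hε4 : ε ≤ 1 / 4) (hεR : 4 ≤ ε * R ^ (1 - s))
    {U : ι → Set ℝ} {d : ι → ℝ} (hd : ∀ i, 0 < d i)
    (hU : ∀ i, ∀ x ∈ U i, ∀ y ∈ U i, dist x y ≤ d i) (hsum : Summable fun i => d i ^ s)
    (hI : ∑' i, {i | (U i ∩ Icc u v).Nonempty}.indicator (fun i => d i ^ s) i ≤
      (v - u) ^ s / 24) :
    ∃ u' v', u ≤ u' ∧ u' < v' ∧ v' ≤ v ∧ v' - u' ≤ (v - u) / 2 ∧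
      ε ≤ q * (v' - u') * Real.exp (q * u') ∧
      (∀ t ∈ Icc u' v', distNearestInt (Real.exp (q * t) - r) ≤ ε) ∧
      ∑' i, {i | (U i ∩ Icc u' v').Nonempty}.indicator (fun i => d i ^ s) i ≤
        (v' - u') ^ s / 24 := by
  set A := Real.exp (q * u) with hAdef
  set B := Real.exp (q * v) with hBdef
  have hℓ : 0 < v - u := sub_pos.2 huv
  have hlogA : Real.log A = q * u := Real.log_exp _
  have hlogB : Real.log B = q * v := Real.log_exp _
  have hApos : 0 < A := by linarith
  have hBpos : 0 < B := Real.exp_pos _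
  have hAB : A + R ≤ B := by
    have h := log_sub_log_le hApos hBpos
    rw [hlogA, hlogB, le_div_iff₀ hApos] at h
    nlinarith
  -- `z` is the least number from `A` on with `z + ε - r` an integer; the children are the preimages
  -- of `[z + k, z + k + 2 * ε]`.
  obtain ⟨z, hz⟩ : ∃ z : ℝ, z = ⌈A + ε - r⌉ + r - ε := ⟨_, rfl⟩
  have hzA : A ≤ z := by have := Int.le_ceil (A + ε - r); linarith
  have hz0 : 0 < z := hApos.trans_le hzA
  have hzA' : z < A + 1 := by have := Int.ceil_lt_add_one (A + ε - r); linarith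
  obtain ⟨N, hN⟩ : ∃ N : ℕ, N = ⌊B - z⌋₊ := ⟨_, rfl⟩
  have hzN : z + N ≤ B := by
    have := Nat.floor_le (a := B - z) (by linarith)
    rw [← hN] at this
    linarith
  have hzN' : B < z + N + 1 := by
    have := Nat.lt_floor_add_one (B - z)
    rw [← hN] at this
    linarith
  have hzk : ∀ k : ℕ, A ≤ z + k := fun k => by
    have : (0 : ℝ) ≤ k := k.cast_nonneg
    linarith
  have hzk1 : ∀ k : ℕ, 0 < z + k := fun k => hApos.trans_le (hzk k)
  let p : ℕ → ℝ := fun k => Real.log (z + k) / q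
  let e : ℕ → ℝ := fun k => Real.log (z + k + 2 * ε) / q
  have hpe : ∀ k, p k < e k := fun k => by
    have := hzk1 k
    exact div_lt_div_of_pos_right (Real.log_lt_log this (by linarith)) hq
  have hep : ∀ k, e k < p (k + 1) := fun k => by
    have := hzk1 k
    refine div_lt_div_of_pos_right (Real.log_lt_log (by linarith) ?_) hq
    push_cast
    linarith
  have hpmono : Monotone p := monotone_nat_of_le_succ fun k => ((hpe k).trans (hep k)).le
  have hup : ∀ k, u ≤ p k := fun k => by
    rw [le_div_iff₀ hq, mul_comm, ← hlogA]
    exact Real.log_le_log hApos (hzk k)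
  have hpv : p N ≤ v := by
    rw [div_le_iff₀ hq, mul_comm v, ← hlogB]
    exact Real.log_le_log (hzk1 N) hzN
  have hev : ∀ k < N, e k ≤ v := fun k hk => ((hep k).le.trans (hpmono hk)).trans hpv
  have hAℓ : 1 / (q * A) ≤ (v - u) / R := by
    rw [div_le_div_iff₀ (by positivity) (by linarith)]
    linarith
  have hRℓ : (v - u) / R ≤ (v - u) / 4 := by gcongr
  have hcell : ∀ k, p (k + 1) - p k ≤ 1 / (q * (z + k)) := fun k => by
    have h := log_sub_log_le (hzk1 k) (hzk1 (k + 1))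
    push_cast at h
    simp only [p]
    rw [← sub_div, mul_comm q, ← div_div]
    gcongr
    push_cast
    calc _ ≤ _ := h
      _ = _ := by ring
  have hcell' : ∀ k, p (k + 1) - p k ≤ (v - u) / R := fun k => by
    refine (hcell k).trans (le_trans ?_ hAℓ)
    gcongr
    exact hzk k
  have hchild : ∀ k, 2 * ε / (q * (z + k + 2 * ε)) ≤ e k - p k := fun k => by
    have := hzk1 k
    have h := le_log_sub_log this (y := z + k + 2 * ε) (by linarith)
    simp only [p, e]
    rw [← sub_div, mul_comm q, ← div_div]
    gcongr
    calc _ = _ := by ring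
      _ ≤ _ := h
  have hchild' : ∀ k, ε / (q * (z + k)) ≤ e k - p k := fun k => by
    have := hzk k
    refine le_trans ?_ (hchild k)
    rw [div_le_div_iff₀ (by positivity) (by positivity)]
    have : q * (z + k + 2 * ε) ≤ q * (2 * (z + k)) := by gcongr; linarith
    nlinarith
  -- The cells miss at most `1 / (q * A) ≤ (v - u) / 4` at each end.
  have htotal : (v - u) / 2 ≤ ∑ k ∈ Finset.range N, (p (k + 1) - p k) := by
    rw [Finset.sum_range_sub]
    have h1 : p 0 - u ≤ 1 / (q * A) := by
      have h := log_sub_log_le hApos (hzk1 0)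
      rw [hlogA] at h
      have h' : (z + (0 : ℕ) - A) / A ≤ 1 / A := by
        gcongr
        push_cast
        linarith
      have : p 0 - u = (Real.log (z + (0 : ℕ)) - q * u) / q := by
        simp only [p]
        field_simp
      rw [this, mul_comm q A, ← div_div]
      gcongr
      linarith
    have h2 : v - p N ≤ 1 / (q * A) := by
      have h := log_sub_log_le (hzk1 N) hBpos
      rw [hlogB] at h
      have h' : (B - (z + N)) / (z + N) ≤ 1 / A := by
        have := hzk N
        gcongr
        linarith
      have : v - p N = (q * v - Real.log (z + N)) / q := by
        simp only [p]
        field_simp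
      rw [this, mul_comm q A, ← div_div]
      gcongr
      linarith
    linarith
  obtain ⟨k, hk, hkle⟩ := exists_sum_indicator_le hs hs1 hℓ hd hsum hI (N := N)
    (C := fun k => p (k + 1) - p k) (fun k _ => sub_pos.2 ((hpe k).trans (hep k))) htotal
    (H := fun k => {i | (U i ∩ Icc (p k) (e k)).Nonempty})
    (fun k hk i hi => hi.mono (inter_subset_inter_right _ (Icc_subset_Icc (hup k) (hev k hk))))
    (fun i k l hkl hl ⟨x, hxU, hx⟩ ⟨y, hyU, hy⟩ => by
      have hdist := hU i y hyU x hxU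
      have hle : p l - e k ≤ d i := by
        have := le_abs_self (y - x)
        rw [Real.dist_eq] at hdist
        linarith [hx.2, hy.1]
      have hsumIco : ∑ j ∈ Finset.Ico k (l + 1), (p (j + 1) - p j) = p (l + 1) - p k :=
        Finset.sum_Ico_sub p (by omega)
      rw [hsumIco]
      have hkl' : (k : ℝ) + 1 ≤ l := by exact_mod_cast hkl
      have hlog := log_cells_le (Z := z + k) (D := l - k) (hA.trans (hzk k)) (by linarith) hε hε4
      have e1 : z + (k : ℝ) + (l - k) = z + l := by ring
      rw [e1] at hlog
      have : p (l + 1) - p k ≤ 6 * (p l - e k) := by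
        simp only [p, e]
        rw [← sub_div, ← sub_div, ← mul_div_assoc]
        gcongr
        push_cast
        rw [← add_assoc]
        exact hlog
      linarith)
  have hzkp : Real.exp (q * p k) = z + k := by
    simp only [p]
    rw [mul_div_cancel₀ _ hq.ne', Real.exp_log (hzk1 k)]
  have hzke : Real.exp (q * e k) = z + k + 2 * ε := by
    simp only [e]
    have := hzk1 k
    rw [mul_div_cancel₀ _ hq.ne', Real.exp_log (by linarith)]
  refine ⟨p k, e k, hup k, hpe k, hev k hk, ?_, ?_, ?_, hkle.trans ?_⟩
  · have := hcell' k
    have := hep k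
    linarith
  · rw [hzkp]
    have h := hchild' k
    have hz0 := hzk1 k
    rw [div_le_iff₀ (by positivity)] at h
    linarith
  · intro t ht
    have h1 : z + k ≤ Real.exp (q * t) := by
      rw [← hzkp]
      exact Real.exp_le_exp.2 (mul_le_mul_of_nonneg_left ht.1 hq.le)
    have h2 : Real.exp (q * t) ≤ z + k + 2 * ε := by
      rw [← hzke]
      exact Real.exp_le_exp.2 (mul_le_mul_of_nonneg_left ht.2 hq.le)
    refine (distNearestInt_le _ (⌈A + ε - r⌉ + k)).trans (abs_le.2 ⟨?_, ?_⟩) <;> push_cast <;>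
      linarith
  · obtain ⟨c, hc⟩ : ∃ c, c = p (k + 1) - p k := ⟨_, rfl⟩
    have hc0 : 0 < c := by have := hpe k; have := hep k; linarith
    have hcR : c ≤ (v - u) / R := hc ▸ hcell' k
    have hR0 : 0 < R := by linarith
    have hεc : ε * c ≤ e k - p k := by
      refine le_trans ?_ (hchild' k)
      rw [div_eq_mul_one_div]
      gcongr
      exact hc ▸ hcell k
    rw [← hc]
    have h1 : 4 * (v - u) ^ (s - 1) * c = 4 * (c / (v - u)) ^ (1 - s) * c ^ s := by
      have : s - 1 = -(1 - s) := by ring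
      rw [Real.div_rpow hc0.le hℓ.le, this, Real.rpow_neg hℓ.le]
      have : c = c ^ (1 - s) * c ^ s := by rw [← Real.rpow_add hc0]; simp
      nth_rewrite 1 [this]
      field_simp
    have h2 : (c / (v - u)) ^ (1 - s) ≤ (1 / R) ^ (1 - s) := by
      refine Real.rpow_le_rpow (by positivity) ?_ (by linarith)
      rw [div_le_div_iff₀ hℓ hR0]
      rw [le_div_iff₀ hR0] at hcR
      linarith
    have h3 : 4 * (1 / R) ^ (1 - s) ≤ ε := by
      rw [Real.div_rpow zero_le_one hR0.le, Real.one_rpow, ← mul_div_assoc, mul_one,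
        div_le_iff₀ (Real.rpow_pos_of_pos hR0 _)]
      exact hεR
    have h4 : ε ≤ ε ^ s := by
      have := Real.rpow_le_rpow_of_exponent_ge hε (by linarith : ε ≤ 1) hs1.le
      rwa [Real.rpow_one] at this
    have hcs : 0 < c ^ s := Real.rpow_pos_of_pos hc0 s
    have : 4 * (v - u) ^ (s - 1) * c ≤ (e k - p k) ^ s := by
      calc 4 * (v - u) ^ (s - 1) * c = 4 * (c / (v - u)) ^ (1 - s) * c ^ s := h1
        _ ≤ ε ^ s * c ^ s := by gcongr; linarith
        _ = (ε * c) ^ s := (Real.mul_rpow hε.le hc0.le).symm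
        _ ≤ _ := Real.rpow_le_rpow (by positivity) hεc hs.le
    linarith

/-! ### Tolerances and the nested intervals -/

/-- Tolerances that tend to zero slowly compared with `exp ∘ g`. -/
theorem exists_tolerances {s : ℝ} (hs : 0 < s) (hs1 : s < 1) {g : ℕ → ℝ}
    (hg : Tendsto g atTop atTop) :
    ∃ ε : ℕ → ℝ, (∀ n, 0 < ε n) ∧ Tendsto ε atTop (𝓝 0) ∧
      (∀ᶠ n in atTop, 4 ≤ ε n * Real.exp (g n)) ∧
      ∀ᶠ n in atTop, 4 ≤ ε (n + 1) * (ε n * Real.exp (g n)) ^ (1 - s) := by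
  obtain ⟨η, hη⟩ : ∃ η, η = (1 - s) / 4 := ⟨_, rfl⟩
  have hη0 : 0 < η := by linarith
  let a : ℕ → ℝ := fun n => Real.exp (-(η * g n))
  have ha : Tendsto a atTop (𝓝 0) :=
    Real.tendsto_exp_neg_atTop_nhds_zero.comp (hg.const_mul_atTop hη0)
  have hbig : ∀ {c : ℝ}, 0 < c → ∀ᶠ n in atTop, 4 ≤ Real.exp (c * g n) := fun hc =>
    (Real.tendsto_exp_atTop.comp (hg.const_mul_atTop hc)).eventually_ge_atTop 4
  have hR : ∀ n, Real.exp ((1 - η) * g n) ≤ max (a n) (a (n - 1)) * Real.exp (g n) := fun n => by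
    calc Real.exp ((1 - η) * g n) = a n * Real.exp (g n) := by
          rw [← Real.exp_add]
          ring_nf
      _ ≤ _ := by gcongr; exact le_max_left _ _
  -- The sequence `g` need not be monotone: `a n` serves the bounds at `n`, and `a (n - 1)` makes `ε
  -- (n + 1)` large enough against `g n`.
  refine ⟨fun n => max (a n) (a (n - 1)), fun n => lt_max_of_lt_left (Real.exp_pos _), ?_, ?_, ?_⟩
  · simpa using ha.max (ha.comp (tendsto_sub_atTop_nat 1))
  · filter_upwards [hbig (c := 1 - η) (by linarith)] with n hn
    exact hn.trans (hR n)
  · have hc : 0 < (1 - η) * (1 - s) - η := by rw [hη]; nlinarith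
    filter_upwards [hbig hc] with n hn
    calc (4 : ℝ) ≤ _ := hn
      _ = a n * Real.exp ((1 - η) * g n) ^ (1 - s) := by
        rw [← Real.exp_mul, ← Real.exp_add]
        ring_nf
      _ ≤ _ := by
        refine mul_le_mul (le_max_right _ _)
          (Real.rpow_le_rpow (Real.exp_pos _).le (hR n) (by linarith))
          (Real.rpow_nonneg (Real.exp_pos _).le _) ((Real.exp_pos _).le.trans (le_max_left _ _))

/-- The theorem in the logarithmic coordinate `t = log α`. -/
theorem le_dimH_exp_approx {q r : ℕ → ℝ} (hq_mono : StrictMono q) (hq_pos : ∀ n, 0 < q n)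
    (hq_gap : Tendsto (fun n => q (n + 1) - q n) atTop atTop) {s L L' : ℝ} (hs : 0 < s)
    (hs1 : s < 1) (hL : 0 < L) (hLL' : L < L') :
    ENNReal.ofReal s ≤ dimH (Icc L L' ∩
      {t | Tendsto (fun n => distNearestInt (Real.exp (q n * t) - r n)) atTop (𝓝 0)}) := by
  obtain ⟨ε, hε0, hεlim, hεR4, hεR⟩ := exists_tolerances hs hs1 (hq_gap.const_mul_atTop hL)
  have hq_lim : Tendsto (fun n => q (n + 1)) atTop atTop :=
    tendsto_atTop_mono (fun n => by have := hq_pos n; linarith) hq_gap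
  have hev := (hεR4.and hεR).and ((hεlim.eventually_le_const (by norm_num : (0 : ℝ) < 1 / 4)).and
    (hq_lim.eventually_ge_atTop (1 / (L' - L))))
  obtain ⟨n₀, hn₀⟩ := eventually_atTop.1 hev
  refine le_dimH_of_forall_exists_notMem hs
    (c := (L' - L) ^ s / 24) (by have := Real.rpow_pos_of_pos (sub_pos.2 hLL') s; positivity) ?_
  intro U d hd hU hsum hle
  let Good : ℕ → ℝ × ℝ → Prop := fun n I => L ≤ I.1 ∧ I.1 < I.2 ∧
    ε n * Real.exp (L * (q (n + 1) - q n)) ≤ q (n + 1) * (I.2 - I.1) * Real.exp (q (n + 1) * I.1) ∧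
    ∑' i, {i | (U i ∩ Icc I.1 I.2).Nonempty}.indicator (fun i => d i ^ s) i ≤
      (I.2 - I.1) ^ s / 24
  have hw : ∀ i, 0 < d i ^ s := fun i => Real.rpow_pos_of_pos (hd i) s
  have hstart : Good n₀ (L, L') := by
    refine ⟨le_rfl, hLL', ?_, ?_⟩
    · have h1 : ε n₀ ≤ 1 := (hn₀ n₀ le_rfl).2.1.trans (by norm_num)
      have h2 : 1 ≤ q (n₀ + 1) * (L' - L) := by
        have := (hn₀ n₀ le_rfl).2.2
        rwa [div_le_iff₀ (sub_pos.2 hLL')] at this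
      have h3 : L * (q (n₀ + 1) - q n₀) ≤ q (n₀ + 1) * L := by
        have := mul_pos hL (hq_pos n₀)
        linarith
      calc ε n₀ * Real.exp (L * (q (n₀ + 1) - q n₀)) ≤ 1 * Real.exp (q (n₀ + 1) * L) := by gcongr
        _ ≤ _ := by gcongr
    · exact (Summable.tsum_le_tsum (fun i => indicator_le_self' (fun i _ => (hw i).le) i)
        (hsum.indicator _) hsum).trans hle
  have hstep : ∀ n, n₀ ≤ n → ∀ I, Good n I → ∃ I' : ℝ × ℝ, Good (n + 1) I' ∧ I.1 ≤ I'.1 ∧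
      I'.2 ≤ I.2 ∧ I'.2 - I'.1 ≤ (I.2 - I.1) / 2 ∧
      ∀ t ∈ Icc I'.1 I'.2, distNearestInt (Real.exp (q (n + 1) * t) - r (n + 1)) ≤ ε (n + 1) := by
    rintro n hn ⟨u, v⟩ ⟨hLu, huv, hR, hI⟩
    obtain ⟨u', v', huu', huv', hvv', hhalf, hlen, happ, hI'⟩ :=
      exists_subinterval (r := r (n + 1)) hs hs1 (hq_pos (n + 1)) huv
        (Real.one_le_exp (mul_pos (hq_pos (n + 1)) (hL.trans_le hLu)).le) hR (hn₀ n hn).1.1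
        (hε0 (n + 1)) (hn₀ (n + 1) (by omega)).2.1 (hn₀ n hn).1.2 hd hU hsum hI
    refine ⟨(u', v'), ⟨hLu.trans huu', huv', ?_, hI'⟩, huu', hvv', hhalf, happ⟩
    have hq := hq_mono (Nat.lt_succ_self (n + 1))
    have hq0 := hq_pos (n + 1)
    have hq1 := hq_pos (n + 1 + 1)
    have hℓ := sub_pos.2 huv'
    have hLu' : L ≤ u' := hLu.trans huu'
    -- Passing to the next exponent multiplies `exp (q t)` at `u' ≥ L` by the exponential of `u'`
    -- times the gap.
    calc ε (n + 1) * Real.exp (L * (q (n + 1 + 1) - q (n + 1)))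
        ≤ q (n + 1) * (v' - u') * Real.exp (q (n + 1) * u') *
          Real.exp (u' * (q (n + 1 + 1) - q (n + 1))) := by
          gcongr
      _ = q (n + 1) * (v' - u') * Real.exp (q (n + 1 + 1) * u') := by
          rw [mul_assoc, ← Real.exp_add]
          ring_nf
      _ ≤ q (n + 1 + 1) * (v' - u') * Real.exp (q (n + 1 + 1) * u') := by
          gcongr
  choose! next hnext using hstep
  let I : ℕ → ℝ × ℝ := fun k => Nat.rec (L, L') (fun k J => next (n₀ + k) J) k
  have hI : ∀ k, Good (n₀ + k) (I k) := by
    intro k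
    induction k with
    | zero => exact hstart
    | succ k ih => exact (hnext (n₀ + k) (by omega) (I k) ih).1
  have hIs : ∀ k, _ := fun k => (hnext (n₀ + k) (by omega) (I k) (hI k)).2
  have hanti : Antitone fun k => Icc (I k).1 (I k).2 :=
    antitone_nat_of_succ_le fun k => Icc_subset_Icc (hIs k).1 (hIs k).2.1
  have hlen : ∀ k, (I k).2 - (I k).1 ≤ (L' - L) * (1 / 2) ^ k := by
    intro k
    induction k with
    | zero => simp [I]
    | succ k ih =>
      calc (I (k + 1)).2 - (I (k + 1)).1 ≤ ((I k).2 - (I k).1) / 2 := (hIs k).2.2.1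
        _ ≤ (L' - L) * (1 / 2) ^ k / 2 := by gcongr
        _ = _ := by ring
  obtain ⟨x, hx⟩ := IsCompact.nonempty_iInter_of_sequence_nonempty_isCompact_isClosed
    (fun k => Icc (I k).1 (I k).2) (fun k => hanti (Nat.le_succ k))
    (fun k => nonempty_Icc.2 (hI k).2.1.le) isCompact_Icc fun k => isClosed_Icc
  rw [mem_iInter] at hx
  refine ⟨x, ⟨hx 0, ?_⟩, fun i hi => ?_⟩
  · refine squeeze_zero' (Eventually.of_forall fun n => abs_nonneg _) ?_ hεlim
    filter_upwards [eventually_ge_atTop (n₀ + 1)] with n hn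
    obtain ⟨k, rfl⟩ := Nat.exists_eq_add_of_le hn
    have := (hIs k).2.2.2 x (hx (k + 1))
    rwa [show n₀ + 1 + k = n₀ + k + 1 by omega]
  -- An obstacle containing `x` meets every interval, so its weight would exceed the allowance once
  -- the interval is shorter than `d i`.
  · have hlim : Tendsto (fun k : ℕ => (L' - L) * (1 / 2 : ℝ) ^ k) atTop (𝓝 0) := by
      simpa using (tendsto_pow_atTop_nhds_zero_of_lt_one (by norm_num : (0 : ℝ) ≤ 1 / 2)
        (by norm_num)).const_mul (L' - L)
    obtain ⟨k, hk⟩ := (hlim.eventually_lt_const (hd i)).exists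
    have hlt : ((I k).2 - (I k).1) ^ s < d i ^ s :=
      Real.rpow_lt_rpow (sub_pos.2 (hI k).2.1).le ((hlen k).trans_lt hk) hs
    have hmem : i ∈ {i | (U i ∩ Icc (I k).1 (I k).2).Nonempty} := ⟨x, hi, hx k⟩
    have h1 := (hsum.indicator {i | (U i ∩ Icc (I k).1 (I k).2).Nonempty}).le_tsum i
      fun j _ => indicator_nonneg (fun i _ => (hw i).le) j
    rw [indicator_of_mem hmem] at h1
    have h2 := (hI k).2.2.2
    have h3 := hw i
    have h4 := Real.rpow_pos_of_pos (sub_pos.2 (hI k).2.1) s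
    linarith

/-! ### Return to the variable `α` -/

/-- The logarithm is 1-Lipschitz on `[1, ∞)`, so it cannot raise dimension: the bound for the
logarithmic image passes to the set itself. -/
theorem dimH_Icc_inter_powerApproxSet {q r : ℕ → ℝ} (hq_mono : StrictMono q)
    (hq_pos : ∀ n, 0 < q n) (hq_gap : Tendsto (fun n => q (n + 1) - q n) atTop atTop)
    {lam δ : ℝ} (hlam : 1 < lam) (hδ : 0 < δ) :
    dimH (Icc lam (lam + δ) ∩ powerApproxSet q r) = 1 := by
  refine le_antisymm ((dimH_mono (subset_univ _)).trans Real.dimH_univ.le) ?_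
  have hlam0 : 0 < lam := by linarith
  have hLip : LipschitzOnWith 1 Real.log (Icc lam (lam + δ) ∩ powerApproxSet q r) := by
    refine LipschitzOnWith.of_dist_le_mul fun x hx y hy => ?_
    have hx1 : 1 ≤ x := hlam.le.trans hx.1.1
    have hy1 : 1 ≤ y := hlam.le.trans hy.1.1
    rw [NNReal.coe_one, one_mul, Real.dist_eq, Real.dist_eq]
    have key : ∀ {a b : ℝ}, 1 ≤ a → 1 ≤ b → Real.log b - Real.log a ≤ |b - a| := fun ha hb =>
      (log_sub_log_le (by linarith) (by linarith)).trans
        ((div_le_div_of_nonneg_right (le_abs_self _) (by linarith)).trans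
          (div_le_self (abs_nonneg _) ha))
    refine abs_le.2 ⟨?_, key hy1 hx1⟩
    have := key hx1 hy1
    rw [abs_sub_comm] at this
    linarith
  refine le_of_forall_lt fun a ha => ?_
  obtain ⟨s, has, hs1⟩ := exists_between ha
  have hsfin : s ≠ ⊤ := hs1.ne_top
  have hs0 : 0 < s.toReal := ENNReal.toReal_pos (bot_le.trans_lt has).ne' hsfin
  have hs1' : s.toReal < 1 := by
    rw [← ENNReal.toReal_one]
    exact (ENNReal.toReal_lt_toReal hsfin ENNReal.one_ne_top).2 hs1
  have h := le_dimH_exp_approx (r := r) hq_mono hq_pos hq_gap hs0 hs1' (Real.log_pos hlam)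
    (Real.log_lt_log hlam0 (by linarith : lam < lam + δ))
  rw [ENNReal.ofReal_toReal hsfin] at h
  refine has.trans_le (h.trans ((dimH_mono ?_).trans hLip.dimH_image_le))
  rintro t ⟨⟨ht1, ht2⟩, ht⟩
  have h1 : lam ≤ Real.exp t := (Real.log_le_iff_le_exp hlam0).1 ht1
  have h2 : Real.exp t ≤ lam + δ := (Real.le_log_iff_exp_le (by linarith)).1 ht2
  refine ⟨Real.exp t, ⟨⟨h1, h2⟩, hlam.trans_le h1, ?_⟩, Real.log_exp t⟩
  simpa only [← Real.exp_mul, mul_comm t, mem_ofPred_eq] using ht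

theorem theorem1p1 (q r : ℕ → ℝ) (hq_mono : StrictMono q) (hq_pos : ∀ n, 0 < q n)
    (hq_gap : Tendsto (fun n => q (n + 1) - q n) atTop atTop) :
    Ioi (1 : ℝ) ⊆ closure (powerApproxSet q r) ∧
      dimH (powerApproxSet q r) = 1 ∧
      ∀ lam δ : ℝ, 1 < lam → 0 < δ →
        dimH (Icc lam (lam + δ) ∩ powerApproxSet q r) = 1 := by
  have key : ∀ lam δ : ℝ, 1 < lam → 0 < δ →
      dimH (Icc lam (lam + δ) ∩ powerApproxSet q r) = 1 := fun lam δ =>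
    dimH_Icc_inter_powerApproxSet hq_mono hq_pos hq_gap
  refine ⟨fun x hx => Metric.mem_closure_iff.2 fun ρ hρ => ?_, ?_, key⟩
  -- A set of dimension 1 is nonempty, which gives density.
  · have hne : (Icc x (x + ρ / 2) ∩ powerApproxSet q r).Nonempty := by
      by_contra h
      have := key x (ρ / 2) hx (half_pos hρ)
      rw [not_nonempty_iff_eq_empty.1 h, dimH_empty] at this
      exact zero_ne_one this
    obtain ⟨y, ⟨hy1, hy2⟩, hy⟩ := hne
    refine ⟨y, hy, ?_⟩
    rw [dist_comm, Real.dist_eq, abs_of_nonneg (by linarith)]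
    linarith
  · refine le_antisymm ((dimH_mono (subset_univ _)).trans Real.dimH_univ.le) ?_
    rw [← key 2 1 one_lt_two one_pos]
    exact dimH_mono inter_subset_right
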